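/- For a finite group $G$ let $\sigma_\iota(G)$ be the number of isomorphism types of subgroups of $G$. For integers $a,b,c\ge 1$ and a field $K$ let $\mathcal{H}_{abc}(K)\le \mathrm{GL}_{a+b+c}(K)$ be the group of all block matrices $$\begin{bmatrix} I_a & U & W\\ 0& I_b & V\\ 0&0&I_c\end{bmatrix},\qquad U\in\mathbb{M}_{a\times b}(K),\ V\in\mathbb{M}_{b\times c}(K),\ W\in\mathbb{M}_{a\times c}(K).$$ (1) There is an absolute constant $D>0$ such that for all primes $p$ and all integers $a,b,c,e\ge 1$, $$\sigma_\iota(\mathcal{H}_{abc}(\mathbb{F}_{p^e}))\le p^{(ab+bc+ac)^2e^2/4+D(ab+bc+ac)e}.$$ (2) For every real $\kappa$ there is a constant $C>0$, depending only on $\kappa$, such that for all primes $p$ and all integers $a,b,c,e\ge 1$ with $a\le\kappa b$ and $b\le \kappa a$, $$p^{(abe)^2/4-C\,abe}\le \sigma_\iota(\mathcal{H}_{abc}(\mathbb{F}_{p^e})).$$ (3) For every real $\kappa$ there is a constant $C>0$, depending only on $\kappa$, such that for all primes $p$ and all integers $a,b,c,e\ge 1$ with $|a-d/2|\le\kappa$,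 $|b-d/2|\le\kappa$ and $c\le\kappa$, where $d=a+b+c$, $$\sigma_\iota(\mathcal{H}_{abc}(\mathbb{F}_{p^e}))\le p^{d^4e^2/64+C d^2e^2},$$ and moreover, if $c\ge 2$, $$p^{d^4e^2/64-C d^2e^2}\le \sigma_\iota(\mathcal{H}_{abc}(\mathbb{F}_{p^e})),$$ while, if $c=1$, $$p^{d^4e^2/64-C(d^2e^2+d^3e)}\le \sigma_\iota(\mathcal{H}_{abc}(\mathbb{F}_{p^e})).$$ So, for $a,b\in d/2+O(1)$ and $c\in O(1)$, $\sigma_\iota(\mathcal{H}_{abc}(\mathbb{F}_{p^e}))\in p^{d^4e^2/64+O(d^2e^2)}$ as soon as $c\ge2$ or $d\in O(e)$. -/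

import Mathlib

/-- Two subgroups are equivalent when they are isomorphic as abstract groups. -/
def subgroupIsoSetoid (G : Type*) [Group G] : Setoid (Subgroup G) where
  r H K := Nonempty (H ≃* K)
  iseqv :=
    { refl := fun H => ⟨MulEquiv.refl H⟩
      symm := fun ⟨f⟩ => ⟨f.symm⟩
      trans := fun ⟨f⟩ ⟨g⟩ => ⟨f.trans g⟩ }

/-- The number `σ_ι(G)` of isomorphism types of subgroups of the (finite) group `G`. -/
noncomputable def sigmaIota (G : Type*) [Group G] : ℕ :=
  Nat.card (Quotient (subgroupIsoSetoid G))

/-- The block matrix with rows `(I_a, U, W)`, `(0, I_b, V)`, `(0, 0, I_c)`. -/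
def heisenbergMatrix {K : Type*} [Field K] {a b c : ℕ} (U : Matrix (Fin a) (Fin b) K)
    (V : Matrix (Fin b) (Fin c) K) (W : Matrix (Fin a) (Fin c) K) :
    Matrix (Fin a ⊕ Fin b ⊕ Fin c) (Fin a ⊕ Fin b ⊕ Fin c) K :=
  Matrix.fromBlocks 1 (Matrix.fromCols U W) 0 (Matrix.fromBlocks 1 V 0 1)

theorem heisenbergMatrix_zero {K : Type*} [Field K] {a b c : ℕ} :
    heisenbergMatrix (0 : Matrix (Fin a) (Fin b) K) (0 : Matrix (Fin b) (Fin c) K) 0 = 1 := by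
  simp [heisenbergMatrix]

theorem heisenbergMatrix_mul {K : Type*} [Field K] {a b c : ℕ}
    (U U' : Matrix (Fin a) (Fin b) K) (V V' : Matrix (Fin b) (Fin c) K)
    (W W' : Matrix (Fin a) (Fin c) K) :
    heisenbergMatrix U V W * heisenbergMatrix U' V' W' =
      heisenbergMatrix (U + U') (V + V') (W + W' + U * V') := by
  unfold heisenbergMatrix
  rw [Matrix.fromBlocks_multiply, Matrix.fromBlocks_multiply, Matrix.fromCols_mul_fromBlocks]
  congr 1
  · simp
  · ext i (j | j)
    · simp [add_comm]
    · simp [add_comm, add_assoc, add_left_comm]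
  · simp
  · simp [add_comm]

/-- The generalized Heisenberg group `H_{abc}(K)`: the block upper unitriangular matrices with
diagonal blocks of sizes `a`, `b`, `c`, as a subgroup of `GL_{a+b+c}(K)` (rows and columns are
indexed by the disjoint union of `Fin a`, `Fin b` and `Fin c`). -/
def heisenbergGroup (K : Type*) [Field K] (a b c : ℕ) :
    Subgroup (Matrix.GeneralLinearGroup (Fin a ⊕ Fin b ⊕ Fin c) K) where
  carrier := {g | ∃ (U : Matrix (Fin a) (Fin b) K) (V : Matrix (Fin b) (Fin c) K)
    (W : Matrix (Fin a) (Fin c) K),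
    (g : Matrix (Fin a ⊕ Fin b ⊕ Fin c) (Fin a ⊕ Fin b ⊕ Fin c) K) = heisenbergMatrix U V W}
  one_mem' := ⟨0, 0, 0, by simp [heisenbergMatrix_zero]⟩
  mul_mem' := by
    rintro g h ⟨U, V, W, hg⟩ ⟨U', V', W', hh⟩
    exact ⟨U + U', V + V', W + W' + U * V', by
      rw [Units.val_mul, hg, hh, heisenbergMatrix_mul]⟩
  inv_mem' := by
    rintro g ⟨U, V, W, hg⟩
    refine ⟨-U, -V, -W + U * V, ?_⟩
    apply Units.inv_eq_of_mul_eq_one_right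
    rw [hg, heisenbergMatrix_mul, ← heisenbergMatrix_zero]
    congr 1 <;> simp

/-! With `U`, `V`, `W` the three matrix blocks, the group is a central extension of `U × V` by `W`
with commutator form `u v' - u' v`, and all three blocks are `F_p`-vector spaces.

Upper bound. A subgroup has an image `L` in `U × V` and a central part `C` in `W`. Two subgroups
sharing both differ by an additive map `L → W / C`. Over `F_p` it lifts to a map `U × V → W`, and
adding that map to the central coordinate is an automorphism of the whole group
(`Heis.nonempty_mulEquiv`). So there are at most as many types as pairs of subspaces, and an
`n`-dimensional space has at most `p ^ (n² / 4 + 2n)` subspaces. In the balanced case `ab + bc = b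
(d - b)` is nearly `d² / 4`, which gives `d⁴e² / 64`.

Lower bound. Take full preimages of `F_p`-subspaces `L` that project onto `V` and contain a few
fixed marks `(m i, 0)`. The centre of such a preimage is `W`, so an isomorphism induces a map `ψ` of
`W` that transports commutators. Prescribing the images of the marks costs a bounded power of the
group order. An isomorphism fixing the marks acts on the `V`-coordinate by a map `χ` with `ψ (m i v)
= m i χ(v)`. The marks include multiples by a generator of `Kˣ`, so `ψ` and `χ` are `K`-linear and
there are few of them. With `ψ` and `χ` prescribed too, only shears `u ↦ u + S v` with `S v * v' = S
v' * v` remain (`Heis.natCard_le_sigmaIota`). These vanish for `c ≥ 2` and are few for `c = 1`.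
Graphs of `F_p`-linear maps supply a family of such `L` of nearly the size allowed by the upper
bound. -/

/-- The group on `U × V × W` with multiplication twisted by the biadditive map `β`. -/
@[ext]
structure Heis {U V W : Type*} [AddCommGroup U] [AddCommGroup V] [AddCommGroup W]
    (β : U →+ V →+ W) where
  u : U
  v : V
  w : W

/-! ### Twisted products and the isomorphism criterion behind the upper bound -/

namespace Heis

variable {U V W : Type*} [AddCommGroup U] [AddCommGroup V] [AddCommGroup W] {β : U →+ V →+ W}

instance : Mul (Heis β) := ⟨fun x y => ⟨x.u + y.u, x.v + y.v, x.w + y.w + β x.u y.v⟩⟩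
instance : One (Heis β) := ⟨⟨0, 0, 0⟩⟩
instance : Inv (Heis β) := ⟨fun x => ⟨-x.u, -x.v, -x.w + β x.u x.v⟩⟩

@[simp] theorem mul_u (x y : Heis β) : (x * y).u = x.u + y.u := rfl
@[simp] theorem mul_v (x y : Heis β) : (x * y).v = x.v + y.v := rfl
@[simp] theorem mul_w (x y : Heis β) : (x * y).w = x.w + y.w + β x.u y.v := rfl
@[simp] theorem one_u : (1 : Heis β).u = 0 := rfl
@[simp] theorem one_v : (1 : Heis β).v = 0 := rfl
@[simp] theorem one_w : (1 : Heis β).w = 0 := rfl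
@[simp] theorem inv_u (x : Heis β) : x⁻¹.u = -x.u := rfl
@[simp] theorem inv_v (x : Heis β) : x⁻¹.v = -x.v := rfl
@[simp] theorem inv_w (x : Heis β) : x⁻¹.w = -x.w + β x.u x.v := rfl

instance : Group (Heis β) :=
  Group.ofLeftAxioms
    (fun x y z => by ext <;> simp [add_assoc, add_left_comm, add_comm])
    (fun x => by ext <;> simp)
    (fun x => by ext <;> simp)

/-- The underlying set of `Heis β`. -/
def equivProd : Heis β ≃ U × V × W where
  toFun x := (x.u, x.v, x.w)
  invFun x := ⟨x.1, x.2.1, x.2.2⟩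
  left_inv _ := rfl
  right_inv _ := rfl

instance [Finite U] [Finite V] [Finite W] : Finite (Heis β) := Finite.of_equiv _ equivProd.symm

theorem natCard : Nat.card (Heis β) = Nat.card U * Nat.card V * Nat.card W := by
  rw [Nat.card_congr equivProd, Nat.card_prod, Nat.card_prod, mul_assoc]

/-- The automorphism of `Heis β` that adds `g (u, v)` to the central coordinate. -/
def shift (g : U × V →+ W) : Heis β ≃* Heis β where
  toFun x := ⟨x.u, x.v, x.w + g (x.u, x.v)⟩
  invFun x := ⟨x.u, x.v, x.w - g (x.u, x.v)⟩
  left_inv x := by ext <;> simp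
  right_inv x := by ext <;> simp
  map_mul' x y := by
    have : g (x.u + y.u, x.v + y.v) = g (x.u, x.v) + g (y.u, y.v) := by
      rw [← map_add]; rfl
    ext
    · simp
    · simp
    · simp only [mul_u, mul_v, mul_w, this]; abel

/-- The image of a subgroup of `Heis β` in `U × V`. -/
def image (H : Subgroup (Heis β)) : AddSubgroup (U × V) where
  carrier := {l | ∃ w, (⟨l.1, l.2, w⟩ : Heis β) ∈ H}
  zero_mem' := ⟨0, H.one_mem⟩
  add_mem' := by
    rintro l l' ⟨w, hw⟩ ⟨w', hw'⟩
    exact ⟨_, H.mul_mem hw hw'⟩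
  neg_mem' := by
    rintro l ⟨w, hw⟩
    exact ⟨_, H.inv_mem hw⟩

/-- The intersection of a subgroup of `Heis β` with the central coordinate group `W`. -/
def centralPart (H : Subgroup (Heis β)) : AddSubgroup W where
  carrier := {w | (⟨0, 0, w⟩ : Heis β) ∈ H}
  zero_mem' := H.one_mem
  add_mem' := by
    intro w w' hw hw'
    have := H.mul_mem hw hw'
    rwa [show (⟨0, 0, w⟩ : Heis β) * ⟨0, 0, w'⟩ = ⟨0, 0, w + w'⟩ by ext <;> simp] at this
  neg_mem' := by
    intro w hw
    have := H.inv_mem hw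
    rwa [show (⟨0, 0, w⟩ : Heis β)⁻¹ = ⟨0, 0, -w⟩ by ext <;> simp] at this

theorem mem_image {H : Subgroup (Heis β)} {l : U × V} :
    l ∈ image H ↔ ∃ w, (⟨l.1, l.2, w⟩ : Heis β) ∈ H := Iff.rfl

theorem mem_centralPart {H : Subgroup (Heis β)} {w : W} :
    w ∈ centralPart H ↔ (⟨0, 0, w⟩ : Heis β) ∈ H := Iff.rfl

theorem sub_mem_centralPart {H : Subgroup (Heis β)} {u : U} {v : V} {w w' : W}
    (h : (⟨u, v, w⟩ : Heis β) ∈ H) (h' : (⟨u, v, w'⟩ : Heis β) ∈ H) :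
    w - w' ∈ centralPart H := by
  have := H.mul_mem h (H.inv_mem h')
  rw [mem_centralPart]
  convert this using 1
  ext <;> simp; abel

theorem mem_of_sub_mem_centralPart {H : Subgroup (Heis β)} {u : U} {v : V} {w w' : W}
    (h : (⟨u, v, w⟩ : Heis β) ∈ H) (h' : w' - w ∈ centralPart H) :
    (⟨u, v, w'⟩ : Heis β) ∈ H := by
  have := H.mul_mem h (mem_centralPart.1 h')
  convert this using 1
  ext <;> simp

/-- Two subgroups of `Heis β` with the same image and the same central part are isomorphic. -/
theorem nonempty_mulEquiv (p : ℕ) [Fact p.Prime] [Module (ZMod p) U] [Module (ZMod p) V]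
    [Module (ZMod p) W] {H H' : Subgroup (Heis β)} (h₁ : image H = image H')
    (h₂ : centralPart H = centralPart H') : Nonempty (H ≃* H') := by
  let L : Submodule (ZMod p) (U × V) := AddSubgroup.toZModSubmodule p (image H)
  let C : Submodule (ZMod p) W := AddSubgroup.toZModSubmodule p (centralPart H)
  have hL : ∀ l, l ∈ L ↔ l ∈ image H := fun l => by simp [L]
  have hC : ∀ l, l ∈ C ↔ l ∈ centralPart H := fun l => by simp [C]
  obtain ⟨s, hs⟩ := (C.mkQ).exists_rightInverse_of_surjective (by simp)
  have hs' : ∀ y, C.mkQ (s y) = y := fun y => by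
    simpa using LinearMap.congr_fun hs y
  have e₁ : ∀ l : L, ∃ w, (⟨l.1.1, l.1.2, w⟩ : Heis β) ∈ H := fun l => (hL _).1 l.2
  have e₂ : ∀ l : L, ∃ w, (⟨l.1.1, l.1.2, w⟩ : Heis β) ∈ H' := fun l =>
    mem_image.1 (h₁ ▸ (hL _).1 l.2)
  choose f₁ hf₁ using e₁
  choose f₂ hf₂ using e₂
  -- Each of `f₁`, `f₂` is additive modulo `C` up to the same cocycle `β`, which cancels in the
  -- difference.
  let g₀ : L →+ W ⧸ C := AddMonoidHom.mk' (fun l => C.mkQ (f₂ l - f₁ l)) (by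
    intro l l'
    rw [← map_add]
    simp only [Submodule.mkQ_apply]
    rw [Submodule.Quotient.eq, hC]
    have k₁ := sub_mem_centralPart (hf₁ (l + l')) (H.mul_mem (hf₁ l) (hf₁ l'))
    have k₂ := sub_mem_centralPart (hf₂ (l + l')) (H'.mul_mem (hf₂ l) (hf₂ l'))
    rw [← h₂] at k₂
    have := (centralPart H).sub_mem k₂ k₁
    convert this using 1
    simp only
    abel)
  -- Subspaces have complements: lift along the section `s` of `W → W ⧸ C`, then extend from `L` to
  -- `U × V`.
  obtain ⟨g, hg⟩ := LinearMap.exists_extend (s ∘ₗ g₀.toZModLinearMap p)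
  have hgl : ∀ l : L, g l - (f₂ l - f₁ l) ∈ centralPart H := by
    intro l
    have : g l = s (C.mkQ (f₂ l - f₁ l)) := LinearMap.congr_fun hg l
    rw [this, ← hC, ← Submodule.Quotient.eq, ← Submodule.mkQ_apply, hs']
    rfl
  have key : H.map (shift g.toAddMonoidHom).toMonoidHom = H' := by
    ext ⟨u, v, w⟩
    rw [Subgroup.mem_map_equiv]
    change (⟨u, v, w - g (u, v)⟩ : Heis β) ∈ H ↔ _
    constructor
    · intro h
      let l : L := ⟨(u, v), (hL _).2 ⟨_, h⟩⟩
      refine mem_of_sub_mem_centralPart (hf₂ l) ?_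
      rw [← h₂]
      have := (centralPart H).add_mem (sub_mem_centralPart h (hf₁ l)) (hgl l)
      convert this using 1
      simp only [l]; abel
    · intro h
      let l : L := ⟨(u, v), (hL _).2 (h₁ ▸ ⟨_, h⟩)⟩
      refine mem_of_sub_mem_centralPart (hf₁ l) ?_
      have h3 := sub_mem_centralPart h (hf₂ l)
      rw [← h₂] at h3
      have := (centralPart H).sub_mem h3 (hgl l)
      convert this using 1
      simp only [l]; abel
  exact ⟨((shift g.toAddMonoidHom).subgroupMap H).trans (MulEquiv.subgroupCongr key)⟩

theorem sigmaIota_le (p : ℕ) [Fact p.Prime] [Module (ZMod p) U] [Module (ZMod p) V]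
    [Module (ZMod p) W] [Finite U] [Finite V] [Finite W] :
    sigmaIota (Heis β) ≤
      Nat.card (Submodule (ZMod p) (U × V)) * Nat.card (Submodule (ZMod p) W) := by
  rw [← Nat.card_prod]
  refine Nat.card_le_card_of_injective
    (fun q : Quotient (subgroupIsoSetoid (Heis β)) =>
      (AddSubgroup.toZModSubmodule p (image q.out),
        AddSubgroup.toZModSubmodule p (centralPart q.out))) ?_
  intro q q' h
  simp only [Prod.mk.injEq, EmbeddingLike.apply_eq_iff_eq] at h
  rw [← q.out_eq, ← q'.out_eq]
  exact Quotient.sound (nonempty_mulEquiv p h.1 h.2)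

end Heis

theorem sigmaIota_le_of_injective {G G' : Type*} [Group G] [Group G'] [Finite G'] (f : G →* G')
    (hf : Function.Injective f) : sigmaIota G ≤ sigmaIota G' := by
  refine Nat.card_le_card_of_injective
    (Quotient.map (sa := subgroupIsoSetoid G) (sb := subgroupIsoSetoid G') (fun H => H.map f) ?_) ?_
  · rintro H H' ⟨e⟩
    exact ⟨(H.equivMapOfInjective f hf).symm.trans (e.trans (H'.equivMapOfInjective f hf))⟩
  · intro q q'
    refine Quotient.inductionOn₂ q q' fun H H' h => Quotient.sound ?_
    obtain ⟨e⟩ := Quotient.exact h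
    exact ⟨(H.equivMapOfInjective f hf).trans (e.trans (H'.equivMapOfInjective f hf).symm)⟩

theorem sigmaIota_congr {G G' : Type*} [Group G] [Group G'] [Finite G'] (f : G ≃* G') :
    sigmaIota G = sigmaIota G' := by
  have : Finite G := Finite.of_equiv _ f.symm.toEquiv
  exact le_antisymm (sigmaIota_le_of_injective f.toMonoidHom f.injective)
    (sigmaIota_le_of_injective f.symm.toMonoidHom f.symm.injective)

/-! ### Counting subspaces over a finite field -/

section SubspaceCount

variable {F E : Type*} [Field F] [Finite F] [AddCommGroup E] [Module F E] [Finite E]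

/-- The product counts ordered bases of one `k`-dimensional subspace. A basis determines its span,
so the bases of all these subspaces are distinct `k`-tuples in `E`. -/
theorem natCard_submodule_finrank_mul_le (k : ℕ) :
    Nat.card {L : Submodule F E // Module.finrank F L = k} *
      ∏ i : Fin k, (Nat.card F ^ k - Nat.card F ^ (i : ℕ)) ≤
      Nat.card F ^ (Module.finrank F E * k) := by
  have := Fintype.ofFinite F
  have hcard : ∀ L : {L : Submodule F E // Module.finrank F L = k},
      Nat.card {s : Fin k → L.1 // LinearIndependent F s} =
        ∏ i : Fin k, (Nat.card F ^ k - Nat.card F ^ (i : ℕ)) := by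
    intro L
    rw [card_linearIndependent (by rw [L.2]), L.2, Nat.card_eq_fintype_card]
  have h1 : Nat.card (Σ L : {L : Submodule F E // Module.finrank F L = k},
      {s : Fin k → L.1 // LinearIndependent F s}) =
      Nat.card {L : Submodule F E // Module.finrank F L = k} *
      ∏ i : Fin k, (Nat.card F ^ k - Nat.card F ^ (i : ℕ)) := by
    have := Fintype.ofFinite {L : Submodule F E // Module.finrank F L = k}
    rw [Nat.card_sigma, Finset.sum_congr rfl (fun L _ => hcard L)]
    simp
  have h2 : Nat.card (Fin k → E) = Nat.card F ^ (Module.finrank F E * k) := by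
    rw [Nat.card_fun, Module.natCard_eq_pow_finrank (K := F) (V := E), pow_mul]
    simp
  rw [← h1, ← h2]
  refine Nat.card_le_card_of_injective (fun x i => ((x.2.1 i : x.1.1) : E)) ?_
  have hspan : ∀ x : (Σ L : {L : Submodule F E // Module.finrank F L = k},
      {s : Fin k → L.1 // LinearIndependent F s}),
      Submodule.span F (Set.range fun i => ((x.2.1 i : x.1.1) : E)) = x.1.1 := by
    rintro ⟨L, s⟩
    have h := s.2.span_eq_top_of_card_eq_finrank' (by simp [L.2])
    have := congrArg (Submodule.map L.1.subtype) h
    rw [Submodule.map_span, Submodule.map_top, Submodule.range_subtype, ← Set.range_comp] at this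
    exact this
  intro x y hxy
  have h := hspan x
  rw [show (fun i => ((x.2.1 i : x.1.1) : E)) = fun i => ((y.2.1 i : y.1.1) : E) from hxy,
    hspan y] at h
  obtain ⟨⟨L, hL⟩, s, hs⟩ := x
  obtain ⟨⟨L', hL'⟩, s', hs'⟩ := y
  simp only at h
  subst h
  simp only [Sigma.mk.injEq, heq_eq_eq, true_and, Subtype.mk.injEq]
  funext i
  exact Subtype.ext (congrFun hxy i)

/-- Each factor is at least `q ^ (k - 1)`, because `q ^ i ≤ q ^ k / 2`. -/
theorem pow_mul_le_prod (q k : ℕ) (hq : 2 ≤ q) :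
    q ^ (k * k) ≤ q ^ k * ∏ i : Fin k, (q ^ k - q ^ (i : ℕ)) := by
  have h : ∀ i : Fin k, q ^ k ≤ q * (q ^ k - q ^ (i : ℕ)) := by
    intro i
    have h1 : q ^ (i : ℕ) * q ≤ q ^ k := by
      rw [← pow_succ]; exact Nat.pow_le_pow_right (by omega) i.2
    have h2 : 2 * q ^ (i : ℕ) ≤ q ^ k :=
      (Nat.mul_le_mul_right _ hq).trans (by rwa [mul_comm])
    obtain ⟨t, ht⟩ := Nat.exists_eq_add_of_le h2
    rw [ht, show 2 * q ^ (i : ℕ) + t - q ^ (i : ℕ) = q ^ (i : ℕ) + t by omega]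
    have := Nat.mul_le_mul_right (q ^ (i : ℕ) + t) hq
    omega
  calc q ^ (k * k) = ∏ _i : Fin k, q ^ k := by simp [pow_mul]
    _ ≤ ∏ i : Fin k, (q * (q ^ k - q ^ (i : ℕ))) := Finset.prod_le_prod' fun i _ => h i
    _ = _ := by simp [Finset.prod_mul_distrib]

theorem natCard_submodule_finrank_le (k : ℕ) :
    Nat.card {L : Submodule F E // Module.finrank F L = k} * Nat.card F ^ (k * k) ≤
      Nat.card F ^ (Module.finrank F E * k + k) := by
  have hq : 2 ≤ Nat.card F := Finite.one_lt_card
  calc _ ≤ Nat.card {L : Submodule F E // Module.finrank F L = k} * (Nat.card F ^ k *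
        ∏ i : Fin k, (Nat.card F ^ k - Nat.card F ^ (i : ℕ))) :=
        Nat.mul_le_mul_left _ (pow_mul_le_prod _ _ hq)
    _ = (Nat.card {L : Submodule F E // Module.finrank F L = k} *
        ∏ i : Fin k, (Nat.card F ^ k - Nat.card F ^ (i : ℕ))) * Nat.card F ^ k := by ring
    _ ≤ _ := by
      rw [pow_add]
      exact Nat.mul_le_mul_right _ (natCard_submodule_finrank_mul_le k)

/-- An `n`-dimensional space over a field with `q` elements has at most `q ^ (n² / 4 + 2 n)`
subspaces. -/
theorem natCard_submodule_le :
    (Nat.card (Submodule F E) : ℝ) ≤ (Nat.card F : ℝ) ^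
      ((Module.finrank F E : ℝ) ^ 2 / 4 + 2 * Module.finrank F E) := by
  set n := Module.finrank F E with hn
  set q := Nat.card F with hqdef
  have hq : 2 ≤ q := Finite.one_lt_card
  have hq0 : (0 : ℝ) < q := by positivity
  have hq1 : (1 : ℝ) ≤ q := by exact_mod_cast (by omega : 1 ≤ q)
  have hk : ∀ k ≤ n, (Nat.card {L : Submodule F E // Module.finrank F L = k} : ℝ) ≤
      (q : ℝ) ^ ((n : ℝ) ^ 2 / 4 + n) := by
    intro k hkn
    have h := natCard_submodule_finrank_le (F := F) (E := E) k
    have h' : (Nat.card {L : Submodule F E // Module.finrank F L = k} : ℝ) * (q : ℝ) ^ (k * k) ≤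
        (q : ℝ) ^ (n * k + k) := by exact_mod_cast h
    rw [← Real.rpow_natCast, ← Real.rpow_natCast, ← le_div_iff₀ (by positivity),
      ← Real.rpow_sub hq0] at h'
    refine h'.trans (Real.rpow_le_rpow_of_exponent_le hq1 ?_)
    push_cast
    have : (k : ℝ) ≤ n := by exact_mod_cast hkn
    -- This is `k (n - k) ≤ n² / 4`.
    nlinarith [sq_nonneg ((n : ℝ) - 2 * k)]
  have hfin := Fintype.ofFinite (Submodule F E)
  have hsum : Nat.card (Submodule F E) =
      ∑ k ∈ Finset.range (n + 1), Nat.card {L : Submodule F E // Module.finrank F L = k} := by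
    classical
    rw [Nat.card_eq_fintype_card, ← Finset.card_univ,
      Finset.card_eq_sum_card_fiberwise (f := fun L : Submodule F E => Module.finrank F L)
        (t := Finset.range (n + 1))]
    · refine Finset.sum_congr rfl fun k _ => ?_
      rw [Nat.card_eq_fintype_card, Fintype.card_subtype]
    · intro L _
      simpa [Nat.lt_succ_iff] using Submodule.finrank_le L
  rw [hsum]
  push_cast
  calc _ ≤ ∑ k ∈ Finset.range (n + 1), (q : ℝ) ^ ((n : ℝ) ^ 2 / 4 + n) :=
        Finset.sum_le_sum fun k hk' => hk k (by simpa [Nat.lt_succ_iff] using hk')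
    _ = (n + 1 : ℝ) * (q : ℝ) ^ ((n : ℝ) ^ 2 / 4 + n) := by simp
    _ ≤ (q : ℝ) ^ (n : ℝ) * (q : ℝ) ^ ((n : ℝ) ^ 2 / 4 + n) := by
        gcongr
        rw [Real.rpow_natCast]
        have : n + 1 ≤ q ^ n := (Nat.lt_pow_self (by omega : 1 < q))
        exact_mod_cast this
    _ = _ := by
        rw [← Real.rpow_add hq0]
        congr 1; ring

end SubspaceCount

/-- Pigeonhole with a relation in place of a labelling function, so that a label may be any choice
of isomorphism data. Fibres need a bound only when they are inhabited. -/
theorem Set.ncard_le_of_fibers {X D : Type*} [Finite X] [Finite D] (s : Set X) (R : X → D → Prop)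
    (B : ℕ) (h₁ : ∀ x ∈ s, ∃ d, R x d)
    (h₂ : ∀ x ∈ s, ∀ d, R x d → {y ∈ s | R y d}.ncard ≤ B) :
    s.ncard ≤ Nat.card D * B := by
  classical
  have := Fintype.ofFinite X
  have := Fintype.ofFinite D
  obtain rfl | ⟨x₀, hx₀⟩ := s.eq_empty_or_nonempty
  · simp
  have : Nonempty D := ⟨(h₁ x₀ hx₀).choose⟩
  choose! f hf using h₁
  rw [Set.ncard_eq_toFinset_card', Nat.card_eq_fintype_card, ← Finset.card_univ, mul_comm]
  refine Finset.card_le_mul_card_image_of_maps_to (f := f) (fun _ _ => Finset.mem_univ _) B ?_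
  intro d _
  by_cases hd : ∃ x ∈ s, f x = d
  · obtain ⟨x, hx, rfl⟩ := hd
    refine le_trans ?_ (h₂ x hx (f x) (hf x hx))
    rw [Set.ncard_eq_toFinset_card']
    refine Finset.card_le_card fun y hy => ?_
    simp only [Finset.mem_filter, Set.mem_toFinset, Set.mem_ofPred_eq] at hy ⊢
    exact ⟨hy.1, hy.2 ▸ hf y hy.1⟩
  · rw [Finset.card_eq_zero.2]
    · exact Nat.zero_le _
    · refine Finset.filter_eq_empty_iff.2 fun x hx hxd => hd ⟨x, ?_, hxd⟩
      simpa using hx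

/-! ### Marked subgroups and isomorphisms of their preimages -/

namespace Heis

variable {U V W : Type*} [AddCommGroup U] [AddCommGroup V] [AddCommGroup W]

/-- The full preimage in `Heis β` of a subgroup of `U × V`. -/
def preimage (β : U →+ V →+ W) (L : AddSubgroup (U × V)) : Subgroup (Heis β) where
  carrier := {x | (x.u, x.v) ∈ L}
  one_mem' := L.zero_mem
  mul_mem' := fun hx hy => L.add_mem hx hy
  inv_mem' := fun hx => L.neg_mem hx

/-- The commutator form of `Heis β`. -/
def form (β : U →+ V →+ W) (x y : Heis β) : W := β x.u y.v - β y.u x.v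

variable {β : U →+ V →+ W} {ι : Type*} {m : ι → U}

theorem mem_preimage {L : AddSubgroup (U × V)} {x : Heis β} :
    x ∈ preimage β L ↔ (x.u, x.v) ∈ L := Iff.rfl

theorem mul_eq_form_mul (x y : Heis β) : x * y = ⟨0, 0, form β x y⟩ * (y * x) := by
  ext <;> simp [form, add_comm]

theorem central_mem (L : AddSubgroup (U × V)) (w : W) : (⟨0, 0, w⟩ : Heis β) ∈ preimage β L :=
  L.zero_mem

/-- The subgroup `L` of `U × V` contains all `(m i, 0)` and projects onto `V`. -/
structure IsMarked (m : ι → U) (L : AddSubgroup (U × V)) : Prop where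
  mark_mem : ∀ i, (m i, 0) ∈ L
  exists_mem : ∀ v, ∃ u, (u, v) ∈ L

/-- The element of `preimage β L` given by a mark. -/
def mark {L : AddSubgroup (U × V)} (hL : IsMarked m L) (i : ι) : preimage β L :=
  ⟨⟨m i, 0, 0⟩, hL.mark_mem i⟩

/-- `L'` arises from `L` by the shear `(u, v) ↦ (u + S v, v)` for some `S` that is symmetric with
respect to `β`. -/
def IsShear (β : U →+ V →+ W) (L L' : AddSubgroup (U × V)) : Prop :=
  ∃ S : V → U, (∀ v v', β (S v) v' = β (S v') v) ∧ ∀ u v, (u, v) ∈ L ↔ (u + S v, v) ∈ L'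

section

variable (hV : ∀ v, (∀ i, β (m i) v = 0) → v = 0) (hU : ∀ u, (∀ v, β u v = 0) → u = 0)
  {L L' L'' : AddSubgroup (U × V)}

include hV hU in
-- Commuting with the marks kills the `V`-coordinate; commuting with lifts of all of `V` then kills
-- the `U`-coordinate.
theorem eq_central_of_commute (hL : IsMarked m L) {x : Heis β}
    (h : ∀ y ∈ preimage β L, x * y = y * x) : x.u = 0 ∧ x.v = 0 := by
  have hform : ∀ y ∈ preimage β L, form β x y = 0 := by
    intro y hy
    have h1 := h y hy
    rw [mul_eq_form_mul] at h1
    have h2 := congrArg Heis.w (mul_eq_right.1 h1)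
    exact h2
  have hv : x.v = 0 := by
    refine hV _ fun i => ?_
    have := hform ⟨m i, 0, 0⟩ (hL.mark_mem i)
    simpa [form] using this
  refine ⟨hU _ fun v => ?_, hv⟩
  obtain ⟨u, hu⟩ := hL.exists_mem v
  have := hform ⟨u, v, 0⟩ hu
  simpa [form, hv] using this

include hV hU in
-- An isomorphism carries the central copy of `W` into the centre, hence into `W`; commutators are
-- transported by this restriction `ψ`.
theorem exists_form_map (hL' : IsMarked m L') (φ : preimage β L ≃* preimage β L') :
    ∃ ψ : W →+ W, Function.Injective ψ ∧
      ∀ x y, form β (φ x : Heis β) (φ y) = ψ (form β (x : Heis β) y) := by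
  let c : W → preimage β L := fun w => ⟨⟨0, 0, w⟩, central_mem L w⟩
  have hc : ∀ w, ((φ (c w) : Heis β).u = 0 ∧ (φ (c w) : Heis β).v = 0) := by
    intro w
    refine eq_central_of_commute hV hU hL' fun y hy => ?_
    obtain ⟨x, hx⟩ := φ.surjective ⟨y, hy⟩
    have : c w * x = x * c w := by
      apply Subtype.ext; ext <;> simp [c, add_comm]
    have h := congrArg (fun z => (φ z : Heis β)) this
    simpa [hx] using h
  have hmul : ∀ w w', c (w + w') = c w * c w' := by
    intro w w'
    apply Subtype.ext; ext <;> simp [c]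
  let ψ : W →+ W := AddMonoidHom.mk' (fun w => (φ (c w) : Heis β).w) (by
    intro w w'
    rw [hmul, map_mul]
    simp [(hc w).1])
  have hψ : ∀ w, (φ (c w) : Heis β) = ⟨0, 0, ψ w⟩ := by
    intro w
    ext
    · exact (hc w).1
    · exact (hc w).2
    · rfl
  refine ⟨ψ, ?_, ?_⟩
  · intro w w' h
    have h1 : (φ (c w) : Heis β) = φ (c w') := by rw [hψ, hψ, h]
    have h2 := φ.injective (Subtype.ext h1)
    exact congrArg (fun z : preimage β L => (z : Heis β).w) h2
  · intro x y
    have h1 : x * y = c (form β (x : Heis β) y) * (y * x) :=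
      Subtype.ext (mul_eq_form_mul (x : Heis β) y)
    have h2 := congrArg (fun z => (φ z : Heis β)) h1
    simp only [map_mul, Subgroup.coe_mul, hψ] at h2
    rw [mul_eq_form_mul] at h2
    have h3 := mul_right_cancel h2
    exact congrArg Heis.w h3

include hV hU in
-- Commutators with the fixed marks show that `ψ` sends `β (m i) x.v` to `β (m i) (φ x).v`. The
-- marks separate points of `V`, so `(φ x).v` depends only on `x.v`.
theorem exists_compat (hL : IsMarked m L) (hL' : IsMarked m L')
    (φ : preimage β L ≃* preimage β L')
    (hφ : ∀ i, (φ (mark hL i) : Heis β) = mark (β := β) hL i) :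
    ∃ (ψ : W →+ W) (χ : V →+ V), Function.Injective ψ ∧ Function.Injective χ ∧
      (∀ i v, ψ (β (m i) v) = β (m i) (χ v)) ∧
      (∀ x y, form β (φ x : Heis β) (φ y) = ψ (form β (x : Heis β) y)) ∧
      ∀ x, (φ x : Heis β).v = χ (x : Heis β).v := by
  obtain ⟨ψ, hψ, hform⟩ := exists_form_map hV hU hL' φ
  have hm : ∀ i (x : preimage β L), β (m i) (φ x : Heis β).v = ψ (β (m i) (x : Heis β).v) := by
    intro i x
    have := hform (mark hL i) x
    rw [hφ] at this
    simpa [form, mark] using this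
  have hex : ∀ v, ∃ x : preimage β L, (x : Heis β).v = v := fun v => by
    obtain ⟨u, hu⟩ := hL.exists_mem v
    exact ⟨⟨⟨u, v, 0⟩, hu⟩, rfl⟩
  choose s hs using hex
  have heq : ∀ v v' : V, (∀ i, β (m i) v = β (m i) v') → v = v' := fun v v' h =>
    sub_eq_zero.1 (hV _ fun i => by rw [map_sub, h, sub_self])
  let χ : V →+ V := AddMonoidHom.mk' (fun v => (φ (s v) : Heis β).v) (by
    intro v v'
    refine heq _ _ fun i => ?_
    rw [map_add, hm, hm, hm, hs, hs, hs, map_add, map_add])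
  have hχ : ∀ i v, ψ (β (m i) v) = β (m i) (χ v) := by
    intro i v
    change _ = β (m i) (φ (s v) : Heis β).v
    rw [hm, hs]
  refine ⟨ψ, χ, hψ, ?_, hχ, hform, fun x => heq _ _ fun i => ?_⟩
  · rw [injective_iff_map_eq_zero]
    intro v hv
    refine hV _ fun i => hψ ?_
    rw [hχ, hv, map_zero, map_zero]
  · rw [hm, hχ]

include hU in
-- Invariance of the form says that `β ((φ x).u - x.u) y.v` is symmetric in `x` and `y`. Its
-- right-hand version involves `x` only through `x.v`, so by nondegeneracy the displacement `(φ x).u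
-- - x.u` is a function of `x.v`.
theorem isShear_of_mulEquiv (hL : IsMarked m L) (φ : preimage β L ≃* preimage β L')
    (h₁ : ∀ x y, form β (φ x : Heis β) (φ y) = form β (x : Heis β) y)
    (h₂ : ∀ x, (φ x : Heis β).v = (x : Heis β).v) : IsShear β L L' := by
  have hex : ∀ v, ∃ x : preimage β L, (x : Heis β).v = v := fun v => by
    obtain ⟨u, hu⟩ := hL.exists_mem v
    exact ⟨⟨⟨u, v, 0⟩, hu⟩, rfl⟩
  have hsym : ∀ x y : preimage β L, β ((φ x : Heis β).u - (x : Heis β).u) (y : Heis β).v =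
      β ((φ y : Heis β).u - (y : Heis β).u) (x : Heis β).v := by
    intro x y
    have h := h₁ x y
    simp only [form, h₂] at h
    simp only [map_sub, AddMonoidHom.sub_apply]
    rw [sub_eq_sub_iff_sub_eq_sub] at h ⊢
    rw [sub_eq_sub_iff_sub_eq_sub, h]
  choose s hs using hex
  have hS : ∀ x : preimage β L, (φ x : Heis β).u =
      (x : Heis β).u + ((φ (s (x : Heis β).v) : Heis β).u - (s (x : Heis β).v : Heis β).u) := by
    intro x
    rw [← sub_eq_iff_eq_add', ← sub_eq_zero]
    refine hU _ fun v => ?_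
    rw [map_sub, AddMonoidHom.sub_apply, sub_eq_zero]
    have h3 := hsym x (s v)
    have h4 := hsym (s (x : Heis β).v) (s v)
    rw [hs] at h3 h4
    rw [h3, h4, hs]
  refine ⟨fun v => (φ (s v) : Heis β).u - (s v : Heis β).u, fun v v' => ?_, fun u v => ?_⟩
  · have := hsym (s v) (s v')
    rwa [hs, hs] at this
  · constructor
    · intro h
      let x : preimage β L := ⟨⟨u, v, 0⟩, h⟩
      have hx := (φ x).2
      rw [mem_preimage, hS, h₂] at hx
      exact hx
    · intro h
      let y : preimage β L' := ⟨⟨_, v, 0⟩, h⟩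
      have hv : (φ.symm y : Heis β).v = v := by
        rw [← h₂, φ.apply_symm_apply]
      have hu := hS (φ.symm y)
      rw [φ.apply_symm_apply, hv] at hu
      have hx := (φ.symm y).2
      rw [mem_preimage, hv, ← add_right_cancel hu] at hx
      exact hx

include hV hU in
/-- A family of marked subgroups of `U × V` yields many isomorphism types of subgroups, as soon as
shears identify few members of the family. -/
theorem natCard_le_sigmaIota [Finite U] [Finite V] [Finite W] [Finite ι] {X : Type*} [Finite X]
    (L : X → AddSubgroup (U × V)) (hL : ∀ x, IsMarked m (L x)) (B : ℕ)
    (hB : ∀ x, {x' | IsShear β (L x) (L x')}.ncard ≤ B) :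
    Nat.card X ≤ sigmaIota (Heis β) * (Nat.card (Heis β) ^ Nat.card ι *
      (Nat.card {f : (W →+ W) × (V →+ V) // ∀ i v, f.1 (β (m i) v) = β (m i) (f.2 v)} * B)) := by
  have : Finite (W →+ W) := Finite.of_injective _ DFunLike.coe_injective
  have : Finite (V →+ V) := Finite.of_injective _ DFunLike.coe_injective
  rw [← Set.ncard_univ, ← Nat.card_fun]
  -- First label: the isomorphism type of the preimage.
  refine Set.ncard_le_of_fibers Set.univ
    (fun x q => (Quotient.mk (subgroupIsoSetoid _) (preimage β (L x))) = q) _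
    (fun x _ => ⟨_, rfl⟩) ?_
  rintro x₀ - _ rfl
  -- Second label: where some isomorphism to a reference preimage sends the marks. Two members with
  -- equal labels are related by an isomorphism fixing the marks.
  refine Set.ncard_le_of_fibers _ (fun x (t : ι → Heis β) =>
    ∃ φ : preimage β (L x) ≃* preimage β (L x₀), ∀ i, (φ (mark (hL x) i) : Heis β) = t i) _ ?_ ?_
  · rintro x ⟨-, hx⟩
    obtain ⟨φ⟩ := Quotient.exact hx
    exact ⟨_, φ, fun i => rfl⟩
  rintro x₁ - t ⟨φ₁, hφ₁⟩
  -- Third label: the induced pair `(ψ, χ)`. For equal pairs the quotient of the two isomorphisms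
  -- preserves the form and the `V`-coordinate, hence yields a shear.
  refine Set.ncard_le_of_fibers _ (fun x
    (f : {f : (W →+ W) × (V →+ V) // ∀ i v, f.1 (β (m i) v) = β (m i) (f.2 v)}) =>
    Function.Injective f.1.1 ∧ Function.Injective f.1.2 ∧
    ∃ φ : preimage β (L x) ≃* preimage β (L x₁),
      (∀ x y, form β (φ x : Heis β) (φ y) = f.1.1 (form β (x : Heis β) y)) ∧
      ∀ x, (φ x : Heis β).v = f.1.2 (x : Heis β).v) _ ?_ ?_
  · rintro x ⟨-, φ, hφ⟩
    obtain ⟨ψ, χ, h1, h2, h3, h4, h5⟩ := exists_compat hV hU (hL x) (hL x₁) (φ.trans φ₁.symm) (by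
      intro i
      have h : φ (mark (hL x) i) = φ₁ (mark (hL x₁) i) := Subtype.ext ((hφ i).trans (hφ₁ i).symm)
      rw [MulEquiv.trans_apply, h, φ₁.symm_apply_apply]
      rfl)
    exact ⟨⟨(ψ, χ), h3⟩, h1, h2, _, h4, h5⟩
  rintro x₂ - f ⟨hψ, hχ, φ₂, h4, h5⟩
  refine le_trans (Set.ncard_le_ncard ?_) (hB x₂)
  rintro x ⟨-, -, -, φ, h6, h7⟩
  refine isShear_of_mulEquiv hU (hL x₂) (φ₂.trans φ.symm) (fun y z => ?_) (fun y => ?_)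
  · apply hψ
    rw [← h6, ← h4]; simp
  · apply hχ
    rw [← h7, ← h5]; simp

end

end Heis

/-! ### The matrix group: shears and marks -/

section MatrixModel

variable {K : Type*} [Field K] {a b c : ℕ}

/-- Matrix multiplication as a biadditive map. -/
def matMul (K : Type*) [Field K] (a b c : ℕ) :
    Matrix (Fin a) (Fin b) K →+ Matrix (Fin b) (Fin c) K →+ Matrix (Fin a) (Fin c) K :=
  AddMonoidHom.mk' (fun u => AddMonoidHom.mk' (fun v => u * v) (Matrix.mul_add u))
    (fun u u' => by ext1 v; exact Matrix.add_mul u u' v)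

@[simp] theorem matMul_apply (u : Matrix (Fin a) (Fin b) K) (v : Matrix (Fin b) (Fin c) K) :
    matMul K a b c u v = u * v := rfl

/-- The representation of `Heis (matMul K a b c)` by block matrices. -/
def heisToMatrix (K : Type*) [Field K] (a b c : ℕ) :
    Heis (matMul K a b c) →* Matrix (Fin a ⊕ Fin b ⊕ Fin c) (Fin a ⊕ Fin b ⊕ Fin c) K where
  toFun x := heisenbergMatrix x.u x.v x.w
  map_one' := heisenbergMatrix_zero
  map_mul' x y := (heisenbergMatrix_mul x.u y.u x.v y.v x.w y.w).symm

theorem heisToMatrix_injective : Function.Injective (heisToMatrix K a b c) := by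
  intro x y h
  change heisenbergMatrix x.u x.v x.w = heisenbergMatrix y.u y.v y.w at h
  unfold heisenbergMatrix at h
  obtain ⟨-, h1, -, h2⟩ := Matrix.fromBlocks_inj.1 h
  obtain ⟨h3, h4⟩ := Matrix.fromCols_inj h1
  obtain ⟨-, h5, -, -⟩ := Matrix.fromBlocks_inj.1 h2
  ext1
  exacts [h3, h5, h4]

/-- The model group is isomorphic to the matrix group. -/
theorem nonempty_heis_mulEquiv :
    Nonempty (Heis (matMul K a b c) ≃* heisenbergGroup K a b c) := by
  let f := (heisToMatrix K a b c).toHomUnits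
  have hf : Function.Injective f := fun x y h =>
    heisToMatrix_injective (congrArg Units.val h)
  have hr : f.range = heisenbergGroup K a b c := by
    ext g
    constructor
    · rintro ⟨x, rfl⟩
      exact ⟨x.u, x.v, x.w, rfl⟩
    · rintro ⟨u, v, w, h⟩
      exact ⟨⟨u, v, w⟩, Units.ext h.symm⟩
  exact ⟨(MonoidHom.ofInjective hf).trans (MulEquiv.subgroupCongr hr)⟩

theorem sigmaIota_heisenbergGroup [Finite K] :
    sigmaIota (heisenbergGroup K a b c) = sigmaIota (Heis (matMul K a b c)) := by
  obtain ⟨f⟩ := nonempty_heis_mulEquiv (K := K) (a := a) (b := b) (c := c)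
  exact sigmaIota_congr f.symm

theorem matrix_mul_single_inj {c : ℕ} {u : Matrix (Fin a) (Fin b) K} (z : Fin c)
    (h : ∀ y, u * (Matrix.single y z 1 : Matrix (Fin b) (Fin c) K) = 0) : u = 0 := by
  ext x y
  have := congrFun (congrFun (h y) x) z
  simpa using this

theorem eq_zero_of_matMul (hc : 0 < c) (u : Matrix (Fin a) (Fin b) K)
    (h : ∀ v, matMul K a b c u v = 0) : u = 0 :=
  matrix_mul_single_inj (⟨0, hc⟩ : Fin c) fun _ => h _

/-- Placing the single column of `V` and of `W` as the first of `c` columns embeds the group for `c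
= 1`. -/
theorem sigmaIota_matMul_one_le [Finite K] (hc : 0 < c) :
    sigmaIota (Heis (matMul K a b 1)) ≤ sigmaIota (Heis (matMul K a b c)) := by
  let e : Matrix (Fin 1) (Fin c) K := Matrix.single 0 ⟨0, hc⟩ 1
  have he : ∀ {n : ℕ} (v v' : Matrix (Fin n) (Fin 1) K), v * e = v' * e → v = v' := by
    intro n v v' h
    ext x y
    have := congrFun (congrFun h x) ⟨0, hc⟩
    rw [Subsingleton.elim y 0]
    simpa [e] using this
  let f : Heis (matMul K a b 1) →* Heis (matMul K a b c) :=
    { toFun := fun x => ⟨x.u, x.v * e, x.w * e⟩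
      map_one' := by ext1 <;> simp
      map_mul' := fun x y => by ext1 <;> simp [Matrix.add_mul, Matrix.mul_assoc] }
  refine sigmaIota_le_of_injective f fun x y h => ?_
  have h' : f x = f y := h
  ext1
  · exact (congrArg Heis.u h' :)
  · exact he _ _ (congrArg Heis.v h' :)
  · exact he _ _ (congrArg Heis.w h' :)

/-! Shears -/

section Shear

variable {S : Matrix (Fin b) (Fin c) K → Matrix (Fin a) (Fin b) K}

/-- By symmetry `S v * v' = S v' * v` is linear in `v`, and `S v` is determined by these products.
-/
theorem shear_linear (hc : 0 < c) (hS : ∀ v v', matMul K a b c (S v) v' = matMul K a b c (S v') v) :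
    ∃ T : Matrix (Fin b) (Fin c) K →ₗ[K] Matrix (Fin a) (Fin b) K, ⇑T = S := by
  simp only [matMul_apply] at hS
  refine ⟨{ toFun := S, map_add' := fun v v' => ?_, map_smul' := fun t v => ?_ }, rfl⟩
  · rw [← sub_eq_zero]
    refine eq_zero_of_matMul hc _ fun y => ?_
    rw [matMul_apply, Matrix.sub_mul, Matrix.add_mul, hS, hS v, hS v', Matrix.mul_add, sub_self]
  · rw [← sub_eq_zero]
    refine eq_zero_of_matMul hc _ fun y => ?_
    simp only [matMul_apply, Matrix.sub_mul, RingHom.id_apply, Matrix.smul_mul]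
    rw [hS, hS v, Matrix.mul_smul, sub_self]

/-- For `z' ≠ z` the product of `S (single y z t)` with `single y' z' 1` lives in column `z'`, while
by symmetry it also lives in column `z`. So it vanishes. -/
theorem shear_eq_zero (hc : 2 ≤ c)
    (hS : ∀ v v', matMul K a b c (S v) v' = matMul K a b c (S v') v) (v : Matrix (Fin b) (Fin c) K) :
    S v = 0 := by
  obtain ⟨T, hT⟩ := shear_linear (by omega) hS
  have : T = 0 := by
    refine Matrix.ext_linearMap _ fun y z => LinearMap.ext fun t => ?_
    change T (Matrix.single y z t) = 0
    have : Nontrivial (Fin c) := Fin.nontrivial_iff_two_le.2 hc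
    obtain ⟨z', hz'⟩ := exists_ne z
    refine matrix_mul_single_inj z' fun y' => ?_
    ext x z''
    by_cases h : z'' = z'
    · have h1 := hS (Matrix.single y z t) (Matrix.single y' z' 1)
      simp only [matMul_apply] at h1
      rw [hT, h1, h]
      simp [Matrix.mul_single_apply_of_ne, hz']
    · simp [Matrix.mul_single_apply_of_ne, h]
  rw [← hT, this]; rfl

theorem natCard_matrix_linearMap [Finite K] (m n m' n' : ℕ) :
    Nat.card (Matrix (Fin m) (Fin n) K →ₗ[K] Matrix (Fin m') (Fin n') K) =
      Nat.card K ^ (m * n * (m' * n')) := by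
  rw [Module.natCard_eq_pow_finrank (K := K), Module.finrank_linearMap]
  simp [Module.finrank_matrix]

theorem ncard_isShear_le [Finite K] (hc : 0 < c) {X : Type*}
    (L : X → AddSubgroup (Matrix (Fin a) (Fin b) K × Matrix (Fin b) (Fin c) K))
    (hL : Function.Injective L) (x : X) :
    {x' | Heis.IsShear (matMul K a b c) (L x) (L x')}.ncard ≤ Nat.card K ^ (b * c * (a * b)) := by
  have hfin : Finite (Matrix (Fin b) (Fin c) K →ₗ[K] Matrix (Fin a) (Fin b) K) :=
    Finite.of_injective _ DFunLike.coe_injective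
  rw [← natCard_matrix_linearMap]
  have : ∀ x' : {x' | Heis.IsShear (matMul K a b c) (L x) (L x')},
      ∃ T : Matrix (Fin b) (Fin c) K →ₗ[K] Matrix (Fin a) (Fin b) K,
        ∀ u v, (u, v) ∈ L x ↔ (u + T v, v) ∈ L x' := by
    rintro ⟨x', S, hS, h⟩
    obtain ⟨T, rfl⟩ := shear_linear hc hS
    exact ⟨T, h⟩
  choose T hT using this
  refine Nat.card_le_card_of_injective T fun x₁ x₂ h => ?_
  refine Subtype.ext (hL ?_)
  ext ⟨u, v⟩
  have h1 := hT x₁ (u - T x₁ v) v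
  have h2 := hT x₂ (u - T x₁ v) v
  rw [← h, h1] at h2
  simpa using h2

theorem ncard_isShear_le_one (hc : 2 ≤ c) {X : Type*}
    (L : X → AddSubgroup (Matrix (Fin a) (Fin b) K × Matrix (Fin b) (Fin c) K))
    (hL : Function.Injective L) (x : X) :
    {x' | Heis.IsShear (matMul K a b c) (L x) (L x')}.ncard ≤ 1 := by
  have : {x' | Heis.IsShear (matMul K a b c) (L x) (L x')} ⊆ {x} := by
    rintro x' ⟨S, hS, h⟩
    refine hL ?_
    ext ⟨u, v⟩
    simpa [shear_eq_zero hc hS] using (h u v).symm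
  simpa using Set.ncard_le_ncard this

end Shear

/-! Marks -/

section Marks

/-- A family of matrices whose images jointly span and whose kernels intersect trivially, together
with their multiples by `lam`. -/
def marks (a b r : ℕ) (lam : K) : Fin r × Bool × Bool → Matrix (Fin a) (Fin b) K :=
  -- The last flag selects the type: `true` sends the basis of `K ^ b` to the `i`-th block of basis
  -- vectors of `K ^ a`, `false` reads off the `i`-th block of `a` coordinates of `K ^ b`.
  fun i => (if i.2.1 then lam else 1) •
    (Matrix.of fun x y => if i.2.2 then (if (x : ℕ) = i.1 * b + y then 1 else 0)
      else (if (y : ℕ) = i.1 * a + x then 1 else 0) : Matrix (Fin a) (Fin b) K)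

theorem marks_lam (a b r : ℕ) (lam : K) (i : Fin r) (s : Bool) :
    marks a b r lam (i, true, s) = lam • marks a b r lam (i, false, s) := by
  simp [marks]

theorem marks_single {r : ℕ} (lam : K) (hr : a ≤ r * b) (x : Fin a) : ∃ (i : Fin r) (y : Fin b),
    ∀ (z : Fin c) (t : K),
      marks a b r lam (i, false, true) * Matrix.single y z t = Matrix.single x z t := by
  have hb : 0 < b := by
    rcases Nat.eq_zero_or_pos b with rfl | h
    · exact absurd x.2 (by omega)
    · exact h
  refine ⟨⟨x / b, Nat.div_lt_of_lt_mul (by rw [mul_comm]; exact x.2.trans_le hr)⟩,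
    ⟨x % b, Nat.mod_lt _ hb⟩, fun z t => ?_⟩
  ext x' z'
  by_cases hz : z' = z
  · subst hz
    have : (x' : ℕ) = x / b * b + x % b ↔ x = x' := by
      rw [Nat.div_add_mod', eq_comm, Fin.ext_iff]
    simp [marks, this, Matrix.single_apply]
  · rw [Matrix.mul_single_apply_of_ne _ _ _ _ _ hz, Matrix.single_apply_of_col_ne _ _ (Ne.symm hz)]

theorem marks_ker {r : ℕ} (lam : K) (hr : b ≤ r * a) (v : Matrix (Fin b) (Fin c) K)
    (h : ∀ i, marks a b r lam i * v = 0) : v = 0 := by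
  ext y z
  have ha : 0 < a := by
    rcases Nat.eq_zero_or_pos a with rfl | h
    · exact absurd y.2 (by omega)
    · exact h
  have h1 := congrFun (congrFun (h (⟨y / a, Nat.div_lt_of_lt_mul
    (by rw [mul_comm]; exact y.2.trans_le hr)⟩, false, false)) ⟨y % a, Nat.mod_lt _ ha⟩) z
  have : ∀ y' : Fin b, (y' : ℕ) = y / a * a + y % a ↔ y' = y := fun y' => by
    rw [Nat.div_add_mod', Fin.ext_iff]
  simpa [marks, this, Matrix.mul_apply] using h1

/-- Every nonzero scalar is a power of the generator `lam`. -/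
theorem exists_linearMap_of_commute {E E' : Type*} [AddCommGroup E] [AddCommGroup E'] [Module K E]
    [Module K E'] [Finite K] {lam : Kˣ} (hlam : ∀ x, x ∈ Subgroup.zpowers lam) (f : E →+ E')
    (h : ∀ x, f ((lam : K) • x) = (lam : K) • f x) : ∃ g : E →ₗ[K] E', g.toAddMonoidHom = f := by
  have hp : ∀ (n : ℕ) x, f ((lam : K) ^ n • x) = (lam : K) ^ n • f x := by
    intro n
    induction n with
    | zero => simp
    | succ n ih => intro x; rw [pow_succ, mul_smul, ih, h, mul_smul]
  refine ⟨{ f with map_smul' := fun t x => ?_ }, rfl⟩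
  change f (t • x) = t • f x
  by_cases ht : t = 0
  · simp [ht]
  · obtain ⟨n, hn⟩ := mem_powers_iff_mem_zpowers.2 (hlam (Units.mk0 t ht))
    have : t = (lam : K) ^ n := by
      have := congrArg Units.val hn
      simpa using this.symm
    rw [this, hp]

/-- The marks `m` and `lam • m` together force `ψ` to commute with `lam` on the span of the images,
which is everything; trivial common kernel passes this to `χ`. Having `K`-linear rather than
additive maps keeps the exponent linear in `e`, as the general lower bound requires. -/
theorem natCard_intertwiner_le [Finite K] {r : ℕ} (hr : a ≤ r * b) (hr' : b ≤ r * a) {lam : Kˣ}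
    (hlam : ∀ x, x ∈ Subgroup.zpowers lam) :
    Nat.card {f : (Matrix (Fin a) (Fin c) K →+ Matrix (Fin a) (Fin c) K) ×
        (Matrix (Fin b) (Fin c) K →+ Matrix (Fin b) (Fin c) K) //
      ∀ i v, f.1 (matMul K a b c (marks a b r (lam : K) i) v) =
        matMul K a b c (marks a b r (lam : K) i) (f.2 v)} ≤
      Nat.card K ^ (a * c * (a * c) + b * c * (b * c)) := by
  have hfin : ∀ m n, Finite (Matrix (Fin m) (Fin n) K →ₗ[K] Matrix (Fin m) (Fin n) K) := fun m n =>
    Finite.of_injective _ DFunLike.coe_injective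
  have := hfin a c
  have := hfin b c
  rw [pow_add, ← natCard_matrix_linearMap, ← natCard_matrix_linearMap, ← Nat.card_prod]
  have key : ∀ f : {f : (Matrix (Fin a) (Fin c) K →+ Matrix (Fin a) (Fin c) K) ×
        (Matrix (Fin b) (Fin c) K →+ Matrix (Fin b) (Fin c) K) //
      ∀ i v, f.1 (matMul K a b c (marks a b r (lam : K) i) v) =
        matMul K a b c (marks a b r (lam : K) i) (f.2 v)},
      ∃ g : (Matrix (Fin a) (Fin c) K →ₗ[K] Matrix (Fin a) (Fin c) K) ×
        (Matrix (Fin b) (Fin c) K →ₗ[K] Matrix (Fin b) (Fin c) K),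
        (g.1.toAddMonoidHom, g.2.toAddMonoidHom) = f.1 := by
    rintro ⟨⟨ψ, χ⟩, h⟩
    simp only [matMul_apply] at h
    have hψ : ψ.comp (DistribSMul.toAddMonoidHom _ (lam : K)) =
        (DistribSMul.toAddMonoidHom _ (lam : K)).comp ψ := by
      refine Matrix.ext_addMonoidHom fun x z => ?_
      ext1 t
      change ψ ((lam : K) • Matrix.single x z t) = (lam : K) • ψ (Matrix.single x z t)
      obtain ⟨i, y, hy⟩ := marks_single (c := c) (lam : K) hr x
      rw [← hy, h, ← Matrix.smul_mul, ← marks_lam, h, marks_lam, Matrix.smul_mul]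
    have hψ' : ∀ w, ψ ((lam : K) • w) = (lam : K) • ψ w := fun w => DFunLike.congr_fun hψ w
    obtain ⟨g₁, hg₁⟩ := exists_linearMap_of_commute hlam ψ hψ'
    obtain ⟨g₂, hg₂⟩ := exists_linearMap_of_commute hlam χ fun v => by
      rw [← sub_eq_zero]
      refine marks_ker (lam : K) hr' _ fun i => ?_
      rw [Matrix.mul_sub, ← h, Matrix.mul_smul, hψ', Matrix.mul_smul, h, sub_self]
    exact ⟨(g₁, g₂), by rw [hg₁, hg₂]⟩
  choose g hg using key
  refine Nat.card_le_card_of_injective g fun f f' h => Subtype.ext ?_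
  rw [← hg, ← hg, h]

end Marks

end MatrixModel

/-! ### Families of marked subgroups from graphs of linear maps -/

section Family

variable {F U V X₁ X₂ : Type*} [Field F] [AddCommGroup U] [AddCommGroup V] [AddCommGroup X₁]
  [AddCommGroup X₂] [Module F U] [Module F V] [Module F X₁] [Module F X₂]

/-- The subgroup of `U × V` cut out by `(π u).2 = T (v, (π u).1)`. -/
def graphSubgroup (π : U →ₗ[F] X₁ × X₂) (T : V × X₁ →ₗ[F] X₂) : AddSubgroup (U × V) where
  carrier := {l | (π l.1).2 = T (l.2, (π l.1).1)}
  zero_mem' := by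
    simp only [Set.mem_ofPred_eq, Prod.fst_zero, Prod.snd_zero, map_zero]
    exact (map_zero T).symm
  add_mem' := by
    intro l l' h h'
    simp only [Set.mem_ofPred_eq, Prod.fst_add, Prod.snd_add, map_add] at h h' ⊢
    rw [h, h', ← map_add]; rfl
  neg_mem' := by
    intro l h
    simp only [Set.mem_ofPred_eq, Prod.fst_neg, Prod.snd_neg, map_neg] at h ⊢
    rw [h, ← map_neg]; rfl

theorem mem_graphSubgroup {π : U →ₗ[F] X₁ × X₂} {T : V × X₁ →ₗ[F] X₂} {u : U} {v : V} :
    (u, v) ∈ graphSubgroup π T ↔ (π u).2 = T (v, (π u).1) := Iff.rfl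

theorem isMarked_graphSubgroup {ι : Type*} {m : ι → U} {π : U →ₗ[F] X₁ × X₂}
    (hπ : Function.Surjective π) (hm : ∀ i, π (m i) = 0) (T : V × X₁ →ₗ[F] X₂) :
    Heis.IsMarked m (graphSubgroup π T) where
  mark_mem i := by
    rw [mem_graphSubgroup, hm]
    exact (map_zero T).symm
  exists_mem v := by
    obtain ⟨u, hu⟩ := hπ (0, T (v, 0))
    exact ⟨u, by rw [mem_graphSubgroup, hu]⟩

theorem apply_eq_of_graphSubgroup {π : U →ₗ[F] X₁ × X₂} (hπ : Function.Surjective π)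
    {T T' : V × X₁ →ₗ[F] X₂} {v : V}
    (h : ∀ u, (u, v) ∈ graphSubgroup π T → (u, v) ∈ graphSubgroup π T') (x : X₁) :
    T (v, x) = T' (v, x) := by
  obtain ⟨u, hu⟩ := hπ (x, T (v, x))
  have := h u (by rw [mem_graphSubgroup, hu])
  rwa [mem_graphSubgroup, hu] at this

theorem graphSubgroup_injective {π : U →ₗ[F] X₁ × X₂} (hπ : Function.Surjective π) :
    Function.Injective (graphSubgroup (V := V) π) := by
  intro T T' h
  refine LinearMap.ext fun ⟨v, x⟩ => apply_eq_of_graphSubgroup hπ (fun u hu => ?_) x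
  rwa [← h]

/-- The quotient of `U` by the span of the marks loses at most one dimension per mark and can be
split in any proportion. -/
theorem exists_surjective_of_marks [Module.Finite F U] {ι : Type*} [Fintype ι] (m : ι → U) :
    ∃ n, n ≤ Module.finrank F U ∧ Module.finrank F U ≤ n + Fintype.card ι ∧
      ∀ s₁ s₂, s₁ + s₂ = n → ∃ π : U →ₗ[F] (Fin s₁ → F) × (Fin s₂ → F),
        Function.Surjective π ∧ ∀ i, π (m i) = 0 := by
  let M := Submodule.span F (Set.range m)
  have h1 := M.finrank_quotient_add_finrank
  have h2 : Module.finrank F M ≤ Fintype.card ι := finrank_range_le_card m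
  refine ⟨Module.finrank F (U ⧸ M), by omega, by omega, fun s₁ s₂ hs => ?_⟩
  let f : (U ⧸ M) ≃ₗ[F] (Fin s₁ → F) × (Fin s₂ → F) := LinearEquiv.ofFinrankEq _ _ (by simp [hs])
  refine ⟨f.toLinearMap ∘ₗ M.mkQ, ?_, fun i => ?_⟩
  · exact f.surjective.comp M.mkQ_surjective
  · have : M.mkQ (m i) = 0 := by
      rw [Submodule.mkQ_apply, Submodule.Quotient.mk_eq_zero]
      exact Submodule.subset_span ⟨i, rfl⟩
    simp only [LinearMap.comp_apply, this, map_zero]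

end Family

/-! ### Counting over a finite field -/

theorem natCard_heis_matMul {p e : ℕ} {K : Type*} [Field K] {a b c : ℕ} (hK : Nat.card K = p ^ e) :
    Nat.card (Heis (matMul K a b c)) = p ^ (e * (a * b + b * c + a * c)) := by
  have : ∀ m n, Nat.card (Matrix (Fin m) (Fin n) K) = p ^ (e * (m * n)) := by
    intro m n
    rw [Module.natCard_eq_pow_finrank (K := K), hK, ← pow_mul]
    simp [Module.finrank_matrix]
  rw [Heis.natCard, this, this, this, ← pow_add, ← pow_add, mul_add, mul_add]

/-- The count of a family of marked subgroups for the matrix group. -/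
theorem pow_le_sigmaIota_mul {p e : ℕ} {K : Type*} [Field K] [Finite K] {a b c r : ℕ}
    (hK : Nat.card K = p ^ e) (hc : 0 < c) (hr : a ≤ r * b)
    (hr' : b ≤ r * a) {lam : Kˣ} (hlam : ∀ x, x ∈ Subgroup.zpowers lam) {X : Type*} [Finite X]
    {s t : ℕ} (hX : Nat.card X = p ^ s)
    (L : X → AddSubgroup (Matrix (Fin a) (Fin b) K × Matrix (Fin b) (Fin c) K))
    (hL : ∀ x, Heis.IsMarked (marks a b r (lam : K)) (L x))
    (hB : ∀ x, {x' | Heis.IsShear (matMul K a b c) (L x) (L x')}.ncard ≤ p ^ t) :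
    p ^ s ≤ sigmaIota (Heis (matMul K a b c)) * p ^ (4 * r * (e * (a * b + b * c + a * c)) +
      e * (a * c * (a * c) + b * c * (b * c)) + t) := by
  have h := Heis.natCard_le_sigmaIota (β := matMul K a b c) (marks_ker (lam : K) hr')
    (eq_zero_of_matMul hc) L hL _ hB
  rw [hX, natCard_heis_matMul hK] at h
  refine h.trans (Nat.mul_le_mul_left _ ?_)
  rw [pow_add, pow_add, mul_assoc]
  refine Nat.mul_le_mul (le_of_eq ?_) (Nat.mul_le_mul_right _ ?_)
  · rw [← pow_mul]
    congr 1
    simp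
    ring
  · refine (natCard_intertwiner_le hr hr' hlam).trans (le_of_eq ?_)
    rw [hK, ← pow_mul]

section LowerBound

variable {p e : ℕ} [Fact p.Prime] {K : Type*} [Field K] [Finite K] [Algebra (ZMod p) K]
  {a b c r : ℕ}

theorem finrank_matrix_zmod (hK : Nat.card K = p ^ e) (m n : ℕ) :
    Module.finrank (ZMod p) (Matrix (Fin m) (Fin n) K) = m * n * e := by
  have : Module.finrank (ZMod p) K = e := by
    have h := Module.natCard_eq_pow_finrank (K := ZMod p) (V := K)
    rw [hK, Nat.card_zmod] at h
    exact (Nat.pow_right_injective (Fact.out : p.Prime).two_le h).symm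
  rw [Module.finrank_matrix, this]; simp

theorem exists_generator_units (K : Type*) [Field K] [Finite K] :
    ∃ lam : Kˣ, ∀ x, x ∈ Subgroup.zpowers lam :=
  IsCyclic.exists_generator

theorem natCard_linearMap_zmod (E E' : Type*) [AddCommGroup E] [AddCommGroup E']
    [Module (ZMod p) E] [Module (ZMod p) E'] [Finite E] [Finite E'] :
    Nat.card (E →ₗ[ZMod p] E') =
      p ^ (Module.finrank (ZMod p) E * Module.finrank (ZMod p) E') := by
  have : Finite (E →ₗ[ZMod p] E') := Finite.of_injective _ DFunLike.coe_injective
  rw [Module.natCard_eq_pow_finrank (K := ZMod p), Module.finrank_linearMap, Nat.card_zmod]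

/-- The family consists of all graphs. The factor `p ^ t` pays for shears: nothing is needed for `c
≥ 2`, and otherwise the number of `K`-linear maps `V → U` suffices. -/
theorem exists_pow_le_sigmaIota_mul (hK : Nat.card K = p ^ e) (hc : 0 < c) (hr : a ≤ r * b)
    (hr' : b ≤ r * a) :
    ∃ n, n ≤ a * b * e ∧ a * b * e ≤ n + 4 * r ∧ ∀ s₁ s₂, s₁ + s₂ = n →
      ∀ t, (2 ≤ c ∨ t = e * (b * c * (a * b))) →
      p ^ ((b * c * e + s₁) * s₂) ≤ sigmaIota (Heis (matMul K a b c)) *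
        p ^ (4 * r * (e * (a * b + b * c + a * c)) +
          e * (a * c * (a * c) + b * c * (b * c)) + t) := by
  obtain ⟨lam, hlam⟩ := exists_generator_units K
  obtain ⟨n, h1, h2, h3⟩ := exists_surjective_of_marks (F := ZMod p) (marks a b r (lam : K))
  rw [finrank_matrix_zmod hK] at h1 h2
  refine ⟨n, h1, h2.trans (by simp; omega), fun s₁ s₂ hs t ht => ?_⟩
  obtain ⟨π, hπ, hm⟩ := h3 s₁ s₂ hs
  have : Finite (Matrix (Fin b) (Fin c) K × (Fin s₁ → ZMod p) →ₗ[ZMod p] (Fin s₂ → ZMod p)) :=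
    Finite.of_injective _ DFunLike.coe_injective
  refine pow_le_sigmaIota_mul hK hc hr hr' hlam
    (X := Matrix (Fin b) (Fin c) K × (Fin s₁ → ZMod p) →ₗ[ZMod p] (Fin s₂ → ZMod p)) ?_
    (graphSubgroup π) (isMarked_graphSubgroup hπ hm) fun x => ?_
  · rw [natCard_linearMap_zmod, Module.finrank_prod, finrank_matrix_zmod hK]
    simp
  · rcases ht with h | rfl
    · exact (ncard_isShear_le_one h _ (graphSubgroup_injective hπ) x).trans
        (Nat.one_le_pow _ _ (Fact.out : p.Prime).pos)
    · rw [pow_mul, ← hK]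
      exact ncard_isShear_le hc _ (graphSubgroup_injective hπ) x

/-- For `c = 1` the shear loss is avoided by using only those `T` that ignore `V`; the price is that
`b * c * e` disappears from the exponent. -/
theorem exists_pow_le_sigmaIota_mul_one (hK : Nat.card K = p ^ e) (hr : a ≤ r * b)
    (hr' : b ≤ r * a) :
    ∃ n, n ≤ a * b * e ∧ a * b * e ≤ n + 4 * r ∧ ∀ s₁ s₂, s₁ + s₂ = n →
      p ^ (s₁ * s₂) ≤ sigmaIota (Heis (matMul K a b 1)) *
        p ^ (4 * r * (e * (a * b + b + a)) + e * (a * a + b * b)) := by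
  obtain ⟨lam, hlam⟩ := exists_generator_units K
  obtain ⟨n, h1, h2, h3⟩ := exists_surjective_of_marks (F := ZMod p) (marks a b r (lam : K))
  rw [finrank_matrix_zmod hK] at h1 h2
  refine ⟨n, h1, h2.trans (by simp; omega), fun s₁ s₂ hs => ?_⟩
  obtain ⟨π, hπ, hm⟩ := h3 s₁ s₂ hs
  have : Finite ((Fin s₁ → ZMod p) →ₗ[ZMod p] (Fin s₂ → ZMod p)) :=
    Finite.of_injective _ DFunLike.coe_injective
  have h := pow_le_sigmaIota_mul (t := 0) hK one_pos hr hr' hlam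
    (X := (Fin s₁ → ZMod p) →ₗ[ZMod p] (Fin s₂ → ZMod p)) (s := s₁ * s₂) (by
      rw [natCard_linearMap_zmod]; simp)
    (fun T => graphSubgroup π (T ∘ₗ LinearMap.snd (ZMod p) (Matrix (Fin b) (Fin 1) K) _))
    (fun T => isMarked_graphSubgroup hπ hm _) fun T => ?_
  · simpa using h
  · have : {T' | Heis.IsShear (matMul K a b 1)
        (graphSubgroup π (T ∘ₗ LinearMap.snd (ZMod p) (Matrix (Fin b) (Fin 1) K) _))
        (graphSubgroup π (T' ∘ₗ LinearMap.snd (ZMod p) (Matrix (Fin b) (Fin 1) K) _))} ⊆ {T} := by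
      rintro T' ⟨S, hS, h⟩
      obtain ⟨S', rfl⟩ := shear_linear one_pos hS
      refine LinearMap.ext fun x => ?_
      -- A linear shear fixes the slice `v = 0`, which already determines `T`.
      exact (apply_eq_of_graphSubgroup hπ
        (T := T ∘ₗ LinearMap.snd (ZMod p) (Matrix (Fin b) (Fin 1) K) _)
        (T' := T' ∘ₗ LinearMap.snd (ZMod p) (Matrix (Fin b) (Fin 1) K) _) (v := 0)
        (fun u hu => by simpa using (h u 0).1 hu) x).symm
    simpa using Set.ncard_le_ncard this

theorem sigmaIota_pos (G : Type*) [Group G] [Finite G] : 0 < sigmaIota G :=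
  Nat.card_pos

theorem sigmaIota_le_rpow (hK : Nat.card K = p ^ e) :
    (sigmaIota (Heis (matMul K a b c)) : ℝ) ≤ (p : ℝ) ^
      ((((a : ℝ) * b + b * c) * e) ^ 2 / 4 + 2 * (((a : ℝ) * b + b * c) * e) +
        (((a : ℝ) * c * e) ^ 2 / 4 + 2 * ((a : ℝ) * c * e))) := by
  have h := Heis.sigmaIota_le (β := matMul K a b c) p
  have h1 := natCard_submodule_le (F := ZMod p)
    (E := Matrix (Fin a) (Fin b) K × Matrix (Fin b) (Fin c) K)
  have h2 := natCard_submodule_le (F := ZMod p) (E := Matrix (Fin a) (Fin c) K)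
  rw [Module.finrank_prod, finrank_matrix_zmod hK, finrank_matrix_zmod hK, Nat.card_zmod] at h1
  rw [finrank_matrix_zmod hK, Nat.card_zmod] at h2
  have hp : (0 : ℝ) < p := by exact_mod_cast (Fact.out : p.Prime).pos
  calc (sigmaIota (Heis (matMul K a b c)) : ℝ) ≤ _ := by exact_mod_cast h
    _ ≤ _ := mul_le_mul h1 h2 (by positivity) (by positivity)
    _ = _ := by
      rw [← Real.rpow_add hp]
      congr 1
      push_cast
      ring

end LowerBound

/-! ### Exponent estimates and the general bounds -/

theorem rpow_le_of_pow_le_mul_pow {p s t A : ℕ} (hp : 1 ≤ p) (h : p ^ s ≤ A * p ^ t) {x : ℝ}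
    (hx : x ≤ s - t) : (p : ℝ) ^ x ≤ A := by
  have hp1 : (1 : ℝ) ≤ p := by exact_mod_cast hp
  have hp0 : (0 : ℝ) < p := by linarith
  refine (Real.rpow_le_rpow_of_exponent_le hp1 hx).trans ?_
  rw [Real.rpow_sub hp0, Real.rpow_natCast, Real.rpow_natCast, div_le_iff₀ (by positivity)]
  exact_mod_cast h

theorem exists_add_eq_four_mul (n : ℕ) : ∃ s₁ s₂, s₁ + s₂ = n ∧ 2 * s₂ ≤ n ∧
    (n : ℝ) ^ 2 - 1 ≤ 4 * ((s₁ : ℝ) * s₂) := by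
  refine ⟨n - n / 2, n / 2, by omega, by omega, ?_⟩
  obtain ⟨k, rfl | rfl⟩ := Nat.even_or_odd' n
  · rw [show 2 * k / 2 = k by omega, show 2 * k - k = k by omega]
    push_cast; nlinarith
  · rw [show (2 * k + 1) / 2 = k by omega, show 2 * k + 1 - k = k + 1 by omega]
    push_cast; nlinarith

theorem sq_sub_le_sq {x z n : ℝ} (hx : 0 ≤ x) (hn : 0 ≤ n) (h : x - z ≤ n) :
    x ^ 2 - 2 * x * z ≤ n ^ 2 := by
  rcases le_total z x with hz | hz
  · nlinarith [sq_nonneg z]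
  · nlinarith [sq_nonneg n, mul_nonneg hx (by linarith : 0 ≤ z - x)]

theorem general_upper_bound : ∃ D : ℝ, 0 < D ∧ ∀ (p : ℕ) [Fact p.Prime] (e a b c : ℕ),
    0 < e → 0 < a → 0 < b → 0 < c →
    (sigmaIota (heisenbergGroup (GaloisField p e) a b c) : ℝ) ≤
      (p : ℝ) ^ (((a : ℝ) * b + b * c + a * c) ^ 2 * (e : ℝ) ^ 2 / 4
        + D * ((a : ℝ) * b + b * c + a * c) * e) := by
  refine ⟨2, two_pos, fun p _ e a b c he ha hb hc => ?_⟩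
  rw [sigmaIota_heisenbergGroup]
  refine (sigmaIota_le_rpow (p := p) (e := e) (GaloisField.card p e he.ne')).trans ?_
  refine Real.rpow_le_rpow_of_exponent_le
    (by exact_mod_cast (Fact.out : p.Prime).one_lt.le) ?_
  -- The cross term gained by completing the square.
  have : (0 : ℝ) ≤ ((a : ℝ) * b + b * c) * e * (a * c * e) := by positivity
  nlinarith

theorem general_lower_bound (κ : ℝ) : ∃ C : ℝ, 0 < C ∧ ∀ (p : ℕ) [Fact p.Prime] (e a b c : ℕ),
    0 < e → 0 < a → 0 < b → 0 < c → (a : ℝ) ≤ κ * b → (b : ℝ) ≤ κ * a →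
    (p : ℝ) ^ (((a : ℝ) * b * e) ^ 2 / 4 - C * ((a : ℝ) * b * e)) ≤
      (sigmaIota (heisenbergGroup (GaloisField p e) a b c) : ℝ) := by
  set r := ⌈κ⌉₊ with hr
  -- With `x = a * b * e`, the losses are `2 r x` from squaring `x - 4 r`, `12 r x` from the images
  -- of the marks, `2 r x` from the intertwiners, and `1 / 4` from parity.
  refine ⟨16 * r + 1, by positivity, fun p _ e a b c he ha hb hc hab hba => ?_⟩
  have har : (a : ℝ) ≤ r * b := hab.trans (by gcongr; exact Nat.le_ceil κ)
  have hbr : (b : ℝ) ≤ r * a := hba.trans (by gcongr; exact Nat.le_ceil κ)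
  rw [sigmaIota_heisenbergGroup]
  have hmono : (sigmaIota (Heis (matMul (GaloisField p e) a b 1)) : ℝ) ≤
      sigmaIota (Heis (matMul (GaloisField p e) a b c)) := by
    exact_mod_cast sigmaIota_matMul_one_le hc
  refine le_trans ?_ hmono
  obtain ⟨n, h1, h2, h3⟩ := exists_pow_le_sigmaIota_mul_one (p := p) (e := e)
    (GaloisField.card p e he.ne') (by exact_mod_cast har) (by exact_mod_cast hbr)
  obtain ⟨s₁, s₂, hs, -, hs'⟩ := exists_add_eq_four_mul n
  refine rpow_le_of_pow_le_mul_pow (Fact.out : p.Prime).one_lt.le (h3 s₁ s₂ hs) ?_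
  push_cast
  have ha1 : (1 : ℝ) ≤ a := by exact_mod_cast ha
  have hb1 : (1 : ℝ) ≤ b := by exact_mod_cast hb
  have he1 : (1 : ℝ) ≤ e := by exact_mod_cast he
  have h2' : (a : ℝ) * b * e - 4 * r ≤ n := by
    rw [sub_le_iff_le_add]; exact_mod_cast h2
  have hsq := sq_sub_le_sq (by positivity) (by positivity) h2'
  have hab' : (a : ℝ) * b + b + a ≤ 3 * (a * b) := by nlinarith
  have hsqs : (a : ℝ) * a + b * b ≤ 2 * r * (a * b) := by nlinarith
  have hone : (1 : ℝ) ≤ a * b * e := by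
    have : (1 : ℝ) ≤ a * b := by nlinarith
    nlinarith
  have e1 : 4 * (r : ℝ) * (e * (a * b + b + a)) ≤ 12 * r * (a * b * e) := by
    have := mul_le_mul_of_nonneg_left hab' (by positivity : 0 ≤ 4 * (r : ℝ) * e)
    linarith
  have e2 : (e : ℝ) * (a * a + b * b) ≤ 2 * r * (a * b * e) := by
    have := mul_le_mul_of_nonneg_left hsqs (by positivity : 0 ≤ (e : ℝ))
    linarith
  linarith

/-! ### The balanced case -/

section Balanced

variable {M a b c d e : ℝ}

/-- Here `a * b + b * c = b * (d - b)`, which differs from `d ^ 2 / 4` by `(b - d / 2) ^ 2`. -/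
theorem balanced_dims (hd : d = a + b + c) (hb : |b - d / 2| ≤ M) :
    d ^ 2 / 4 - M ^ 2 ≤ a * b + b * c ∧ a * b + b * c ≤ d ^ 2 / 4 := by
  have h : a * b + b * c = d ^ 2 / 4 - (b - d / 2) ^ 2 := by rw [hd]; ring
  have h2 : (b - d / 2) ^ 2 ≤ M ^ 2 := sq_le_sq' (abs_le.1 hb).1 (abs_le.1 hb).2
  constructor <;> nlinarith [sq_nonneg (b - d / 2)]

theorem balanced_upper_exponent (hd : d = a + b + c)
    (hb : |b - d / 2| ≤ M) (hc : c ≤ M) (ha1 : 1 ≤ a) (hb1 : 1 ≤ b) (hc1 : 1 ≤ c) (he : 1 ≤ e) :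
    (((a * b + b * c) * e) ^ 2 / 4 + 2 * ((a * b + b * c) * e) +
      ((a * c * e) ^ 2 / 4 + 2 * (a * c * e))) ≤
    d ^ 4 * e ^ 2 / 64 + (1 + M ^ 2 + 2 * M) * (d ^ 2 * e ^ 2) := by
  obtain ⟨-, h⟩ := balanced_dims hd hb
  have hM : 1 ≤ M := hc1.trans hc
  have hd1 : 1 ≤ d := by linarith
  have h0 : 0 ≤ a * b + b * c := by positivity
  have hac : a * c ≤ M * d := by nlinarith
  have hac0 : 0 ≤ a * c * e := by positivity
  have h1 : (a * b + b * c) * e ≤ d ^ 2 / 4 * e := by gcongr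
  have h2 : ((a * b + b * c) * e) ^ 2 ≤ (d ^ 2 / 4 * e) ^ 2 := by gcongr
  have h3 : a * c * e ≤ M * d * e := by gcongr
  have h4 : (a * c * e) ^ 2 ≤ (M * d * e) ^ 2 := by gcongr
  have hde : d ^ 2 * e ≤ d ^ 2 * e ^ 2 := by gcongr; nlinarith
  have hde' : M * (d * e) ≤ M * (d ^ 2 * e ^ 2) := by
    have : d * e ≤ (d * e) ^ 2 := by nlinarith [mul_le_mul hd1 he (by norm_num) (by linarith)]
    rw [mul_pow] at this
    exact mul_le_mul_of_nonneg_left this (by linarith)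
  have h5 : 0 ≤ M ^ 2 * (d ^ 2 * e ^ 2) := by positivity
  have h6 : 0 ≤ d ^ 2 * e ^ 2 := by positivity
  linarith [mul_pow M (d * e) 2, mul_pow d e 2]

theorem balanced_lower_exponent {n s : ℝ} (hd : d = a + b + c)
    (hb : |b - d / 2| ≤ M) (hc : c ≤ M) (ha1 : 1 ≤ a) (hb1 : 1 ≤ b) (hc1 : 1 ≤ c) (he : 1 ≤ e)
    (hn : a * b * e ≤ n + 12) (hn0 : 0 ≤ n) (hs : (b * c * e + n) ^ 2 - 1 ≤ 4 * s) :
    d ^ 4 * e ^ 2 / 64 - (30 + 3 * M ^ 2) * (d ^ 2 * e ^ 2) ≤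
      s - (4 * 3 * (e * (a * b + b * c + a * c)) + e * (a * c * (a * c) + b * c * (b * c))) := by
  obtain ⟨h, h'⟩ := balanced_dims hd hb
  have hM : 1 ≤ M := hc1.trans hc
  have hd1 : 1 ≤ d := by linarith
  have hz : d ^ 2 / 4 * e - (M ^ 2 + 12) * e ≤ b * c * e + n := by
    have := mul_le_mul_of_nonneg_right h (by linarith : 0 ≤ e)
    linarith
  have hsq := sq_sub_le_sq (by positivity) (by positivity) hz
  have hac : a * c ≤ M * d := by nlinarith
  have hbc : b * c ≤ M * d := by nlinarith
  have h1 : a * c * (a * c) + b * c * (b * c) ≤ 2 * (M ^ 2 * d ^ 2) := by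
    have h1 : a * c * (a * c) ≤ M * d * (M * d) := by gcongr
    have h2 : b * c * (b * c) ≤ M * d * (M * d) := by gcongr
    linarith
  have h2 : a * b + b * c + a * c ≤ d ^ 2 := by
    rw [hd]; nlinarith [mul_pos (by linarith : 0 < a) (by linarith : 0 < b),
      mul_pos (by linarith : 0 < b) (by linarith : 0 < c),
      mul_pos (by linarith : 0 < a) (by linarith : 0 < c), sq_nonneg a, sq_nonneg b, sq_nonneg c]
  have h3 : e * (a * c * (a * c) + b * c * (b * c)) ≤ e * (2 * (M ^ 2 * d ^ 2)) := by gcongr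
  have h4 : e * (a * b + b * c + a * c) ≤ e * d ^ 2 := by gcongr
  have hee : e ≤ e ^ 2 := by nlinarith
  have h5 : e * d ^ 2 ≤ d ^ 2 * e ^ 2 := by
    rw [mul_comm]; gcongr
  have h6 : M ^ 2 * (e * d ^ 2) ≤ M ^ 2 * (d ^ 2 * e ^ 2) := by gcongr
  have h7 : 1 ≤ d ^ 2 * e ^ 2 := one_le_mul_of_one_le_of_one_le (by nlinarith) (by nlinarith)
  have h8 : 0 ≤ M ^ 2 * (d ^ 2 * e ^ 2) := by positivity
  linarith

end Balanced

theorem balanced_lower_bound (M : ℕ) (p : ℕ) [Fact p.Prime] (e a b c d : ℕ) (he : 0 < e)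
    (ha : 0 < a) (hb : 0 < b) (hc : 0 < c) (hd : d = a + b + c)
    (had : |(a : ℝ) - (d : ℝ) / 2| ≤ M) (hbd : |(b : ℝ) - (d : ℝ) / 2| ≤ M) (hcM : (c : ℝ) ≤ M)
    (t : ℕ) (ht : 2 ≤ c ∨ t = e * (b * c * (a * b))) :
    (p : ℝ) ^ ((d : ℝ) ^ 4 * (e : ℝ) ^ 2 / 64
        - ((30 + 3 * (M : ℝ) ^ 2) + (4 * M + 24) ^ 2) * ((d : ℝ) ^ 2 * (e : ℝ) ^ 2) - t) ≤
      (sigmaIota (heisenbergGroup (GaloisField p e) a b c) : ℝ) := by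
  have hp1 : (1 : ℝ) ≤ p := by exact_mod_cast (Fact.out : p.Prime).one_lt.le
  rw [sigmaIota_heisenbergGroup]
  have ha1 : (1 : ℝ) ≤ a := by exact_mod_cast ha
  have hb1 : (1 : ℝ) ≤ b := by exact_mod_cast hb
  have hc1 : (1 : ℝ) ≤ c := by exact_mod_cast hc
  have he1 : (1 : ℝ) ≤ e := by exact_mod_cast he
  have hd' : (d : ℝ) = a + b + c := by rw [hd]; push_cast; ring
  have hde0 : (0 : ℝ) ≤ (d : ℝ) ^ 2 * (e : ℝ) ^ 2 := by positivity
  have ht0 : (0 : ℝ) ≤ t := by positivity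
  -- For small `d` the term `(4 * M + 24) ^ 2` makes the exponent nonpositive and the bound trivial.
  -- For large `d` it ensures `c + 12 ≤ a` and that `r = 3` is admissible, giving `4 * 3 = 12`
  -- marks.
  rcases le_total (d : ℝ) (4 * M + 24) with hsmall | hlarge
  · have h1 : (1 : ℝ) ≤ sigmaIota (Heis (matMul (GaloisField p e) a b c)) := by
      exact_mod_cast sigmaIota_pos _
    refine le_trans (Real.rpow_le_one_of_one_le_of_nonpos hp1 ?_) h1
    have h2 : (d : ℝ) ^ 2 ≤ (4 * M + 24) ^ 2 := by gcongr
    have h3 : (d : ℝ) ^ 2 * (d ^ 2 * e ^ 2) ≤ (4 * M + 24) ^ 2 * (d ^ 2 * e ^ 2) := by gcongr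
    have h4 : 0 ≤ (30 + 3 * (M : ℝ) ^ 2) * (d ^ 2 * e ^ 2) := by positivity
    have h5 : 0 ≤ (d : ℝ) ^ 2 * (d ^ 2 * e ^ 2) := by positivity
    linarith [show (d : ℝ) ^ 4 * e ^ 2 = (d : ℝ) ^ 2 * (d ^ 2 * e ^ 2) by ring]
  · obtain ⟨ha2, ha3⟩ := abs_le.1 had
    obtain ⟨hb2, hb3⟩ := abs_le.1 hbd
    have har : (a : ℝ) ≤ 3 * b := by linarith
    have hbr : (b : ℝ) ≤ 3 * a := by linarith
    have hac : (c : ℝ) + 12 ≤ a := by linarith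
    obtain ⟨n, -, h2, h3⟩ := exists_pow_le_sigmaIota_mul (p := p) (e := e) (r := 3)
      (GaloisField.card p e he.ne') hc (by exact_mod_cast har) (by exact_mod_cast hbr)
    -- Needed so that `s₂`, about half of `b * c * e + n`, fits inside `n`.
    have hvn : b * c * e ≤ n := by
      have h4 : c + 12 ≤ a := by exact_mod_cast hac
      have h5 : b * (c + 12) * e ≤ b * a * e := by gcongr
      have h6 : 1 * 12 * 1 ≤ b * 12 * e := by gcongr <;> omega
      have h7 : b * (c + 12) * e = b * c * e + b * 12 * e := by ring
      rw [h7, mul_comm b a] at h5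
      omega
    obtain ⟨s₁, s₂, hs, hs2, hs'⟩ := exists_add_eq_four_mul (b * c * e + n)
    have hs₁ : b * c * e + (n - s₂) = s₁ := by omega
    have h4 := h3 (n - s₂) s₂ (by omega) t ht
    rw [hs₁] at h4
    refine rpow_le_of_pow_le_mul_pow (Fact.out : p.Prime).one_lt.le h4 ?_
    push_cast at hs' ⊢
    have h5 := balanced_lower_exponent hd' hbd hcM ha1 hb1 hc1 he1
      (n := n) (by exact_mod_cast h2) (by positivity) hs'
    have h6 : 0 ≤ (4 * (M : ℝ) + 24) ^ 2 * (d ^ 2 * e ^ 2) := by positivity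
    linarith

theorem mainTheorem6 :
    -- the general upper bound, with an absolute constant
    (∃ D : ℝ, 0 < D ∧ ∀ (p : ℕ) [Fact p.Prime] (e a b c : ℕ),
      0 < e → 0 < a → 0 < b → 0 < c →
      (sigmaIota (heisenbergGroup (GaloisField p e) a b c) : ℝ) ≤
        (p : ℝ) ^ (((a : ℝ) * b + b * c + a * c) ^ 2 * (e : ℝ) ^ 2 / 4
          + D * ((a : ℝ) * b + b * c + a * c) * e)) ∧
    -- the general lower bound, uniform as long as `a / b` and `b / a` stay bounded
    (∀ κ : ℝ, ∃ C : ℝ, 0 < C ∧ ∀ (p : ℕ) [Fact p.Prime] (e a b c : ℕ),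
      0 < e → 0 < a → 0 < b → 0 < c → (a : ℝ) ≤ κ * b → (b : ℝ) ≤ κ * a →
      (p : ℝ) ^ (((a : ℝ) * b * e) ^ 2 / 4 - C * ((a : ℝ) * b * e)) ≤
        (sigmaIota (heisenbergGroup (GaloisField p e) a b c) : ℝ)) ∧
    -- the case `a, b ∈ d / 2 + O(1)`, `c ∈ O(1)`, where `d = a + b + c`
    (∀ κ : ℝ, ∃ C : ℝ, 0 < C ∧ ∀ (p : ℕ) [Fact p.Prime] (e a b c d : ℕ),
      0 < e → 0 < a → 0 < b → 0 < c → d = a + b + c →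
      |(a : ℝ) - (d : ℝ) / 2| ≤ κ → |(b : ℝ) - (d : ℝ) / 2| ≤ κ → (c : ℝ) ≤ κ →
      (sigmaIota (heisenbergGroup (GaloisField p e) a b c) : ℝ) ≤
          (p : ℝ) ^ ((d : ℝ) ^ 4 * (e : ℝ) ^ 2 / 64 + C * ((d : ℝ) ^ 2 * (e : ℝ) ^ 2)) ∧
      (2 ≤ c →
        (p : ℝ) ^ ((d : ℝ) ^ 4 * (e : ℝ) ^ 2 / 64 - C * ((d : ℝ) ^ 2 * (e : ℝ) ^ 2)) ≤
          (sigmaIota (heisenbergGroup (GaloisField p e) a b c) : ℝ)) ∧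
      (c = 1 →
        (p : ℝ) ^ ((d : ℝ) ^ 4 * (e : ℝ) ^ 2 / 64
            - C * ((d : ℝ) ^ 2 * (e : ℝ) ^ 2 + (d : ℝ) ^ 3 * e)) ≤
          (sigmaIota (heisenbergGroup (GaloisField p e) a b c) : ℝ))) := by
  refine ⟨general_upper_bound, general_lower_bound, fun κ => ?_⟩
  set M := ⌈κ⌉₊ with hM
  have hκ : κ ≤ M := Nat.le_ceil κ
  refine ⟨(30 + 3 * (M : ℝ) ^ 2) + (4 * M + 24) ^ 2, by positivity,
    fun p _ e a b c d he ha hb hc hd had hbd hcM => ?_⟩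
  have hp1 : (1 : ℝ) ≤ p := by exact_mod_cast (Fact.out : p.Prime).one_lt.le
  have had' := had.trans hκ
  have hbd' := hbd.trans hκ
  have hcM' := hcM.trans hκ
  have hd' : (d : ℝ) = a + b + c := by rw [hd]; push_cast; ring
  have hde0 : (0 : ℝ) ≤ (d : ℝ) ^ 2 * (e : ℝ) ^ 2 := by positivity
  refine ⟨?_, fun hc2 => ?_, fun hc1 => ?_⟩
  · rw [sigmaIota_heisenbergGroup]
    refine (sigmaIota_le_rpow (p := p) (e := e) (GaloisField.card p e he.ne')).trans ?_
    refine Real.rpow_le_rpow_of_exponent_le hp1 ?_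
    refine (balanced_upper_exponent hd' hbd' hcM' (by exact_mod_cast ha)
      (by exact_mod_cast hb) (by exact_mod_cast hc) (by exact_mod_cast he)).trans ?_
    gcongr _ + ?_ * _
    nlinarith [sq_nonneg (M : ℝ), Nat.cast_nonneg (α := ℝ) M]
  · simpa using balanced_lower_bound M p e a b c d he ha hb hc hd had' hbd' hcM' 0 (Or.inl hc2)
  -- For `c = 1` the shears cost `e * (b * c * (a * b)) ≤ d ^ 3 * e`, the extra error term.
  · refine le_trans (Real.rpow_le_rpow_of_exponent_le hp1 ?_)
      (balanced_lower_bound M p e a b c d he ha hb hc hd had' hbd' hcM' _ (Or.inr rfl))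
    have had1 : a ≤ d := by omega
    have hbd1 : b ≤ d := by omega
    have h1 : e * (b * c * (a * b)) ≤ e * (d * 1 * (d * d)) := by
      rw [hc1]; gcongr
    have h2 : ((e * (b * c * (a * b)) : ℕ) : ℝ) ≤ (d : ℝ) ^ 3 * e := by
      calc ((e * (b * c * (a * b)) : ℕ) : ℝ) ≤ ((e * (d * 1 * (d * d)) : ℕ) : ℝ) := by
            exact_mod_cast h1
        _ = _ := by push_cast; ring
    have h3 : (1 : ℝ) * ((d : ℝ) ^ 3 * e) ≤
        ((30 + 3 * (M : ℝ) ^ 2) + (4 * M + 24) ^ 2) * ((d : ℝ) ^ 3 * e) := by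
      gcongr
      nlinarith [sq_nonneg (M : ℝ), sq_nonneg (4 * (M : ℝ) + 24)]
    linarith
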